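/- **Setting.** Let $\mathcal M\subseteq\mathbb R^n$ be a smooth embedded submanifold with the metric induced by the Euclidean inner product. Let $R:\mathrm T\mathcal M\to\mathcal M$, $(x,v)\mapsto R_x(v)$, be a retraction, i.e. a smooth map with $R_x(0_x)=x$ and $\mathrm D R_x(0_x)=\mathrm{id}_{\mathrm T_x\mathcal M}$ for all $x\in\mathcal M$. Let $h:\mathbb R^n\to\mathbb R$ be convex. Write $\partial$ for the Clarke generalized subdifferential of a real function on a Euclidean space. **Lemma.** For every $x\in\mathcal M$ there are an open neighborhood $\hat U_x\subseteq\mathrm T_x\mathcal M$ of $0_x$ and an open neighborhood $U\subseteq\mathcal M$ of $x$ such that: 1. $R_x:\hat U_x\to U$ is a diffeomorphism. 2. The pullback $\hat h_x=h\circ R_x$ is weakly convex on $\hat U_x$: it is locally Lipschitz there, and there is a $\rho>0$ such that $$\hat h_x(\eta)\ \ge\ \hat h_x(\omega)+\langle g,\eta-\omega\rangle-\tfrac{\rho}{2}\|\eta-\omega\|^2\qquad\text{for all }\eta,\omega\in\hat U_x\text{ and }g\in\partial\hat h_x(\omega).$$ 3. $h$ is weakly retraction-convex on $U$ with respect to $R$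 (with tangent vectors taken from neighborhoods on which the retraction is a diffeomorphism). That is, $h|_U$ is locally Lipschitz, and there are a constant $\rho>0$ and, for each $y\in U$, an open neighborhood $D_y\subseteq\mathrm T_y\mathcal M$ of $0_y$, with $\hat U_x\subseteq D_x$, such that the following two properties hold for every $y\in U$. First, $R_y$ is a diffeomorphism from $D_y$ onto an open subset of $\mathcal M$ containing $U$. Second, for every $S\subseteq D_y$ with $R_y(S)\subseteq U$, the function $\tilde h_y(\eta)=h(R_y(\eta))+\frac{\rho}{2}\|\eta\|^2$ on $\mathrm T_y\mathcal M$ has a nonempty subdifferential $\partial\tilde h_y(\omega)$ at every $\omega\in S$, and $$\tilde h_y(\eta)\ \ge\ \tilde h_y(\omega)+\langle v,\eta-\omega\rangle\qquad\text{for all }\eta,\omega\in S\text{ and }v\in\partial\tilde h_y(\omega).$$ -/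

import Mathlib

open Set Filter Topology
open scoped ContDiff

noncomputable section

/-- `M ⊆ ℝⁿ` is a smooth embedded submanifold of dimension `d`: around each of its points there is
a smooth diffeomorphism `Φ` between open subsets of `ℝⁿ` that flattens `M` onto a piece of a
`d`-dimensional linear subspace (a slice chart). -/
def IsEmbeddedSubmanifold {n : ℕ} (d : ℕ) (M : Set (EuclideanSpace ℝ (Fin n))) : Prop :=
  ∀ x ∈ M, ∃ (Φ : OpenPartialHomeomorph (EuclideanSpace ℝ (Fin n)) (EuclideanSpace ℝ (Fin n)))
    (V : Submodule ℝ (EuclideanSpace ℝ (Fin n))),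
    x ∈ Φ.source ∧ ContDiffOn ℝ ∞ Φ Φ.source ∧ ContDiffOn ℝ ∞ Φ.symm Φ.target ∧
    Module.finrank ℝ V = d ∧ Φ '' (Φ.source ∩ M) = Φ.target ∩ V

/-- The tangent space `T_x M`, as a subspace of `ℝⁿ`: the velocities `c'(0)` of smooth curves `c`
in `M` with `c(0) = x`. (For an embedded submanifold these velocities already form a linear
subspace, so that taking the span adds nothing.) It carries the inner product of `ℝⁿ`. -/
def tangentSpaceOf {n : ℕ} (M : Set (EuclideanSpace ℝ (Fin n))) (x : EuclideanSpace ℝ (Fin n)) :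
    Submodule ℝ (EuclideanSpace ℝ (Fin n)) :=
  Submodule.span ℝ {v | ∃ (c : ℝ → EuclideanSpace ℝ (Fin n)) (ε : ℝ), 0 < ε ∧
    ContDiffOn ℝ ∞ c (Ioo (-ε) ε) ∧ (∀ t ∈ Ioo (-ε) ε, c t ∈ M) ∧ c 0 = x ∧ HasDerivAt c v 0}

/-- A retraction on `M`: a smooth map `R : TM → M` with `R_x(0) = x` and `D R_x(0) = id`.
Smoothness on `TM = {(x, v) | x ∈ M, v ∈ T_x M} ⊆ ℝⁿ × ℝⁿ` means that around each point of `TM`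
the map has a smooth extension to an open subset of `ℝⁿ × ℝⁿ`. -/
structure IsRetraction {n : ℕ} (M : Set (EuclideanSpace ℝ (Fin n)))
    (R : (x : M) → tangentSpaceOf M x → M) : Prop where
  smooth : ∀ (x : M) (v : tangentSpaceOf M x),
    ∃ (W : Set (EuclideanSpace ℝ (Fin n) × EuclideanSpace ℝ (Fin n)))
      (F : EuclideanSpace ℝ (Fin n) × EuclideanSpace ℝ (Fin n) → EuclideanSpace ℝ (Fin n)),
      IsOpen W ∧ ((x : EuclideanSpace ℝ (Fin n)), (v : EuclideanSpace ℝ (Fin n))) ∈ W ∧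
      ContDiffOn ℝ ∞ F W ∧
      ∀ (y : M) (w : tangentSpaceOf M y),
        ((y : EuclideanSpace ℝ (Fin n)), (w : EuclideanSpace ℝ (Fin n))) ∈ W →
          F (y, w) = R y w
  map_zero : ∀ x : M, R x 0 = x
  hasFDerivAt_zero : ∀ x : M,
    HasFDerivAt (fun v => (R x v : EuclideanSpace ℝ (Fin n))) (tangentSpaceOf M x).subtypeL 0

/-- `f` restricts to a smooth diffeomorphism from the open set `A` of the vector space `T` onto the
(relatively) open subset `B` of the submanifold `M ⊆ ℝⁿ`. The inverse `B → A` is smooth in the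
sense that it has smooth local extensions to open subsets of `ℝⁿ`. -/
def IsDiffeoOnto {n : ℕ} {M : Set (EuclideanSpace ℝ (Fin n))}
    {T : Type*} [NormedAddCommGroup T] [NormedSpace ℝ T] (f : T → M) (A : Set T) (B : Set M) :
    Prop :=
  IsOpen A ∧ IsOpen B ∧ BijOn f A B ∧
  ContDiffOn ℝ ∞ (fun v => (f v : EuclideanSpace ℝ (Fin n))) A ∧
  ∀ y ∈ B, ∃ (W : Set (EuclideanSpace ℝ (Fin n))) (G : EuclideanSpace ℝ (Fin n) → T),
    IsOpen W ∧ (y : EuclideanSpace ℝ (Fin n)) ∈ W ∧ ContDiffOn ℝ ∞ G W ∧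
    ∀ v ∈ A, (f v : EuclideanSpace ℝ (Fin n)) ∈ W → G (f v) = v

/-- Clarke's generalized directional derivative
`f°(x; v) = limsup_{y → x, t ↓ 0} (f (y + t v) - f y) / t`. -/
def clarkeDeriv {T : Type*} [NormedAddCommGroup T] [NormedSpace ℝ T] (f : T → ℝ) (x v : T) :
    EReal :=
  limsup (fun p : T × ℝ => (((f (p.1 + p.2 • v) - f p.1) / p.2 : ℝ) : EReal))
    (𝓝 x ×ˢ 𝓝[>] (0 : ℝ))

/-- Clarke's generalized subdifferential `∂f(x) = {g | ⟨g, v⟩ ≤ f°(x; v) for all v}`. -/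
def clarkeSubdiff {T : Type*} [NormedAddCommGroup T] [InnerProductSpace ℝ T] (f : T → ℝ) (x : T) :
    Set T :=
  {g | ∀ v : T, ((inner ℝ g v : ℝ) : EReal) ≤ clarkeDeriv f x v}

/-- `f` is weakly convex on `A`: it is locally Lipschitz there, and for some `ρ > 0` one has
`f η ≥ f w + ⟨g, η - w⟩ - (ρ/2) ‖η - w‖²` for all `w, η ∈ A` and every `g ∈ ∂f(w)`. -/
def IsWeaklyConvexOn {T : Type*} [NormedAddCommGroup T] [InnerProductSpace ℝ T] (f : T → ℝ)
    (A : Set T) : Prop :=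
  LocallyLipschitzOn A f ∧
  ∃ ρ : ℝ, 0 < ρ ∧ ∀ w ∈ A, ∀ η ∈ A, ∀ g ∈ clarkeSubdiff f w,
    f η ≥ f w + inner ℝ g (η - w) - ρ / 2 * ‖η - w‖ ^ 2

/-- `h` is `ρ`-retraction-convex on `Ω ⊆ M` with respect to `R`, where the tangent vectors at `x`
are taken from the domain `D x` of the retraction: `h` is locally Lipschitz on `Ω`, and for all
`x ∈ Ω` and all `S ⊆ D x` with `R_x(S) ⊆ Ω`, the function `h̃_x(η) = h(R_x(η)) + (ρ/2) ‖η‖²` has a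
subgradient at every `w ∈ S`, and any such subgradient `v` satisfies
`h̃_x(η) ≥ h̃_x(w) + ⟨v, η - w⟩` for all `η ∈ S`.

(Local Lipschitz continuity is with respect to the distance of `ℝⁿ`; on an embedded submanifold
this is the same as with respect to the Riemannian distance, as the two are locally comparable.) -/
def RetractionConvexOn {n : ℕ} {M : Set (EuclideanSpace ℝ (Fin n))}
    (R : (x : M) → tangentSpaceOf M x → M) (D : (x : M) → Set (tangentSpaceOf M x))
    (ρ : ℝ) (h : M → ℝ) (Ω : Set M) : Prop :=
  LocallyLipschitzOn Ω h ∧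
  ∀ x ∈ Ω, ∀ S ⊆ D x, R x '' S ⊆ Ω →
    ∀ w ∈ S, (clarkeSubdiff (fun ξ => h (R x ξ) + ρ / 2 * ‖ξ‖ ^ 2) w).Nonempty ∧
      ∀ v ∈ clarkeSubdiff (fun ξ => h (R x ξ) + ρ / 2 * ‖ξ‖ ^ 2) w, ∀ η ∈ S,
        h (R x η) + ρ / 2 * ‖η‖ ^ 2 ≥ h (R x w) + ρ / 2 * ‖w‖ ^ 2 + inner ℝ v (η - w)

end

/-!
The retraction `R` is, near `(x, 0)`, the restriction to `TM` of a smooth map `F` on an open subset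
of `ℝⁿ × ℝⁿ`. Hence there is one radius `r` such that for *every* `y ∈ M` within `r` of `x`, the map
`R_y` on the `r`-ball of `T_y M` is smooth with a `K`-Lipschitz derivative, `K` independent of `y`.
Since `D R_y(0)` is the inclusion `T_y M ⊆ ℝⁿ`, shrinking `r` makes `D R_y` differ from the
inclusion by at most `1/2`; so `R_y` is injective, bi-Lipschitz and immersive on the `r`-ball. No
smooth choice of frames of the tangent spaces is needed.

*Convexity.* A map with `K`-Lipschitz derivative satisfies
`‖f (a η + b ζ) - (a f η + b f ζ)‖ ≤ K a b ‖η - ζ‖²`, and `h` is convex and `L`-Lipschitz near `x`,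
so `h ∘ R_y + (ρ/2)‖·‖²` is convex on the `r`-ball of `T_y M` once `ρ ≥ 2 L K`
(`convexOn_comp_add_sq`). Both subgradient inequalities then follow from
`le_of_mem_clarkeSubdiff`, which bounds the difference quotients in Clarke's directional derivative
using convexity, and subgradients exist by Hahn–Banach (`ConvexOn.clarkeSubdiff_nonempty`).

*Diffeomorphisms.* An injective immersion of an open subset of a `d`-dimensional space into `M`,
read in a slice chart and projected to the `d`-dimensional model subspace, is a local diffeomorphism
by the inverse function theorem (`isDiffeoOnto_image`); here `dim T_y M = d` is
`finrank_tangentSpaceOf`.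

*Uniform image.* Let `A` be the ball of radius `r/12` in `T_x M`, `U = R_x(A)`, and `D_y` the ball
of radius `r/2` in `T_y M`. For `y ∈ U`, the image `R_y(D_y)` is open, and by the
lower Lipschitz bound the points of `U` in the compact set `R_y(closure D_y)` already lie in
`R_y(D_y)`. So `U ∩ R_y(D_y)` is clopen in the connected set `U`, which gives `U ⊆ R_y(D_y)`
(`image_subset_image_ball`). This replaces a quantitative inverse function theorem.
-/

open Set Filter Topology
open scoped ContDiff

/-! ### Convexity and Clarke subgradients -/

/-- Clarke subgradients of a function `f` that is convex up to the quadratic `(ρ/2)‖·‖²` satisfy the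
subgradient inequality up to the same quadratic. For `ρ = 0` this is the usual inequality for convex
functions. -/
theorem le_of_mem_clarkeSubdiff {T : Type*} [NormedAddCommGroup T] [InnerProductSpace ℝ T]
    {f : T → ℝ} {C : Set T} {ρ : ℝ} (hC : IsOpen C)
    (hf : ConvexOn ℝ C (fun ξ => f ξ + ρ / 2 * ‖ξ‖ ^ 2)) (hc : ContinuousOn f C)
    {w η g : T} (hw : w ∈ C) (hη : η ∈ C) (hg : g ∈ clarkeSubdiff f w) :
    f w + inner ℝ g (η - w) - ρ / 2 * ‖η - w‖ ^ 2 ≤ f η := by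
  obtain ⟨d, rfl⟩ : ∃ d, η = w + d := ⟨η - w, by abel⟩
  rw [add_sub_cancel_left]
  -- For base points `p` near `w` and steps `0 < t < 1`, convexity between `p` and `p + d` bounds the
  -- difference quotient by an expression continuous in `(p, t)`, whose limit is the claimed bound.
  have key : clarkeDeriv f w d ≤ ((f (w + d) - f w + ρ / 2 * (1 - 0) * ‖d‖ ^ 2 : ℝ) : EReal) := by
    have hlim : Tendsto (fun p : T × ℝ =>
        ((f (p.1 + d) - f p.1 + ρ / 2 * (1 - p.2) * ‖d‖ ^ 2 : ℝ) : EReal))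
        (𝓝 w ×ˢ 𝓝[>] (0 : ℝ))
        (𝓝 ((f (w + d) - f w + ρ / 2 * (1 - 0) * ‖d‖ ^ 2 : ℝ) : EReal)) := by
      refine (continuous_coe_real_ereal.tendsto _).comp ?_
      have h1 : Tendsto (fun p : T × ℝ => p.1) (𝓝 w ×ˢ 𝓝[>] (0 : ℝ)) (𝓝 w) := tendsto_fst
      have h2 : Tendsto (fun p : T × ℝ => p.2) (𝓝 w ×ˢ 𝓝[>] (0 : ℝ)) (𝓝 0) :=
        tendsto_snd.mono_right nhdsWithin_le_nhds
      have h3 := (hc.continuousAt (hC.mem_nhds hη)).tendsto.comp (h1.add_const d)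
      have h4 := (hc.continuousAt (hC.mem_nhds hw)).tendsto.comp h1
      exact (h3.sub h4).add (((tendsto_const_nhds.sub h2).const_mul _).mul_const _)
    rw [← hlim.limsup_eq]
    refine limsup_le_limsup ?_
    have hC1 : ∀ᶠ p in 𝓝 w, p ∈ C ∧ p + d ∈ C :=
      (hC.eventually_mem hw).and
        ((continuous_add_const d).tendsto w (hC.mem_nhds hη))
    have ht : ∀ᶠ t in 𝓝[>] (0 : ℝ), 0 < t ∧ t < 1 := Ioo_mem_nhdsGT one_pos
    filter_upwards [hC1.prod_mk ht] with ⟨p, t⟩ ⟨⟨hp, hpd⟩, ht0, ht1⟩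
    simp only at hp hpd ht0 ht1 ⊢
    refine EReal.coe_le_coe_iff.2 ?_
    have h := hf.2 hp hpd (sub_nonneg.2 ht1.le) ht0.le (sub_add_cancel _ _)
    have e : (1 - t) • p + t • (p + d) = p + t • d := by module
    simp only [e, smul_eq_mul] at h
    rw [div_le_iff₀ ht0]
    have n1 := norm_add_sq_real p d
    have n2 := norm_add_sq_real p (t • d)
    rw [norm_smul, inner_smul_right, Real.norm_eq_abs, abs_of_pos ht0] at n2
    rw [n1, n2] at h
    nlinarith
  have := EReal.coe_le_coe_iff.1 ((hg d).trans key)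
  linarith

/-- A continuous convex function on an open set has a subgradient at each point: separate the point
`(w, f w)` of the graph from the open strict epigraph. -/
theorem ConvexOn.exists_subgradient {T : Type*} [NormedAddCommGroup T] [InnerProductSpace ℝ T]
    [CompleteSpace T] {f : T → ℝ} {C : Set T} (hC : IsOpen C) (hf : ConvexOn ℝ C f)
    (hc : ContinuousOn f C) {w : T} (hw : w ∈ C) :
    ∃ g : T, ∀ p ∈ C, f w + inner ℝ g (p - w) ≤ f p := by
  have hopen : IsOpen {p : T × ℝ | p.1 ∈ C ∧ f p.1 < p.2} := by
    have h1 : ContinuousOn (fun p : T × ℝ => p.2 - f p.1) (C ×ˢ univ) :=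
      continuousOn_snd.sub (hc.comp continuousOn_fst fun p hp => hp.1)
    convert h1.isOpen_inter_preimage (hC.prod isOpen_univ) (isOpen_Ioi (a := 0)) using 1
    ext p
    simp
  obtain ⟨Λ, hΛ⟩ := geometric_hahn_banach_open_point (x := (w, f w)) hf.convex_strict_epigraph
    hopen (by simp)
  have hsplit : ∀ (p : T) (t : ℝ), Λ (p, t) = Λ (p, 0) + t * Λ (0, 1) := by
    intro p t
    have : ((p, t) : T × ℝ) = (p, 0) + t • (0, 1) := by simp
    rw [this, map_add, map_smul, smul_eq_mul]
  set c := Λ (0, 1)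
  -- The separating functional is not vertical, as the epigraph contains points above `(w, f w)`.
  have hcneg : c < 0 := by
    have := hΛ (w, f w + 1) ⟨hw, by simp⟩
    rw [hsplit, hsplit w (f w)] at this
    linarith
  refine ⟨(InnerProductSpace.toDual ℝ T).symm ((-c)⁻¹ • Λ.comp (.inl ℝ T ℝ)), fun p hp => ?_⟩
  rw [InnerProductSpace.toDual_symm_apply]
  have hle : Λ (p, 0) + f p * c ≤ Λ (w, 0) + f w * c := by
    refine le_of_forall_pos_lt_add fun ε hε => ?_
    have := hΛ (p, f p + ε / (-c)) ⟨hp, by simpa using div_pos hε (neg_pos.2 hcneg)⟩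
    rw [hsplit, hsplit w (f w)] at this
    have h2 : ε / (-c) * c = -ε := by
      rw [div_neg, neg_mul, div_mul_cancel₀ ε hcneg.ne]
    linarith
  have hd : Λ (p - w, 0) = Λ (p, 0) - Λ (w, 0) := by
    rw [← map_sub]; simp
  simp only [smul_apply, ContinuousLinearMap.comp_apply,
    ContinuousLinearMap.inl_apply, smul_eq_mul, hd]
  have : (-c)⁻¹ * (Λ (p, 0) - Λ (w, 0)) ≤ f p - f w := by
    rw [inv_mul_le_iff₀ (neg_pos.2 hcneg)]
    linarith
  linarith

theorem ConvexOn.clarkeSubdiff_nonempty {T : Type*} [NormedAddCommGroup T]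
    [InnerProductSpace ℝ T] [CompleteSpace T] {f : T → ℝ} {C : Set T} (hC : IsOpen C)
    (hf : ConvexOn ℝ C f) (hc : ContinuousOn f C) {w : T} (hw : w ∈ C) :
    (clarkeSubdiff f w).Nonempty := by
  obtain ⟨g, hg⟩ := hf.exists_subgradient hC hc hw
  refine ⟨g, fun v => le_limsup_of_frequently_le' ?_⟩
  have hev : ∀ᶠ t in 𝓝[>] (0 : ℝ),
      ((inner ℝ g v : ℝ) : EReal) ≤ (((f (w + t • v) - f w) / t : ℝ) : EReal) := by
    have hcont : Tendsto (fun t : ℝ => w + t • v) (𝓝[>] 0) (𝓝 w) := by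
      have : Continuous fun t : ℝ => w + t • v := by fun_prop
      simpa using (this.tendsto 0).mono_left nhdsWithin_le_nhds
    filter_upwards [hcont (hC.mem_nhds hw), self_mem_nhdsWithin] with t ht ht0
    have ht0' : 0 < t := ht0
    refine EReal.coe_le_coe_iff.2 ?_
    have := hg _ ht
    rw [add_sub_cancel_left, inner_smul_right] at this
    rw [le_div_iff₀ ht0']
    linarith
  -- Quotients based at `w` itself already bound the limsup from below.
  have hle : Tendsto (fun t : ℝ => (w, t)) (𝓝[>] 0) (𝓝 w ×ˢ 𝓝[>] 0) :=
    tendsto_const_nhds.prodMk tendsto_id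
  exact hle.frequently hev.frequently

/-- A map whose derivative is `K`-Lipschitz on a convex set is affine up to the error
`K a b ‖η - ζ‖²` along each segment: expand to first order at the point `a η + b ζ`; the linear terms
cancel. -/
theorem norm_map_combination_sub_le {T E : Type*} [NormedAddCommGroup T] [NormedSpace ℝ T]
    [NormedAddCommGroup E] [NormedSpace ℝ E] {f : T → E} {f' : T → T →L[ℝ] E} {C : Set T}
    {K : ℝ} (hC : Convex ℝ C) (hf : ∀ z ∈ C, HasFDerivAt f (f' z) z) (hK : 0 ≤ K)
    (hLip : ∀ z ∈ C, ∀ z' ∈ C, ‖f' z - f' z'‖ ≤ K * ‖z - z'‖)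
    {η ζ : T} (hη : η ∈ C) (hζ : ζ ∈ C) {a b : ℝ} (ha : 0 ≤ a) (hb : 0 ≤ b) (hab : a + b = 1) :
    ‖f (a • η + b • ζ) - (a • f η + b • f ζ)‖ ≤ K * (a * b * ‖η - ζ‖ ^ 2) := by
  set m := a • η + b • ζ with hm
  have hmC : m ∈ C := hC hη hζ ha hb hab
  have taylor : ∀ z ∈ C, ‖f z - f m - f' m (z - m)‖ ≤ K * ‖z - m‖ ^ 2 := by
    intro z hz
    have hseg : segment ℝ m z ⊆ C := hC.segment_subset hmC hz
    have := (convex_segment m z).norm_image_sub_le_of_norm_hasFDerivWithin_le' (φ := f' m)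
      (C := K * ‖z - m‖) (fun u hu => (hf u (hseg hu)).hasFDerivWithinAt)
      (fun u hu => (hLip u (hseg hu) m hmC).trans
        (mul_le_mul_of_nonneg_left (norm_sub_le_of_mem_segment hu) hK))
      (left_mem_segment ℝ m z) (right_mem_segment ℝ m z)
    linarith
  have e1 : η - m = b • (η - ζ) := by
    have : η - m = (a + b) • η - m := by rw [hab, one_smul]
    rw [this, hm]; module
  have e2 : ζ - m = -(a • (η - ζ)) := by
    have : ζ - m = (a + b) • ζ - m := by rw [hab, one_smul]
    rw [this, hm]; module
  have h1 := taylor η hη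
  have h2 := taylor ζ hζ
  rw [e1, norm_smul, Real.norm_of_nonneg hb] at h1
  rw [e2, norm_neg, norm_smul, Real.norm_of_nonneg ha] at h2
  have e : f m - (a • f η + b • f ζ)
      = -(a • (f η - f m - f' m (b • (η - ζ))) + b • (f ζ - f m - f' m (-(a • (η - ζ))))) := by
    have : f m = (a + b) • f m := by rw [hab, one_smul]
    rw [map_neg, map_smul, map_smul]
    nth_rewrite 1 [this]
    module
  rw [e, norm_neg]
  refine (norm_add_le _ _).trans ?_
  rw [norm_smul, norm_smul, Real.norm_of_nonneg ha, Real.norm_of_nonneg hb]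
  have h3 := mul_le_mul_of_nonneg_left h1 ha
  have h4 := mul_le_mul_of_nonneg_left h2 hb
  have hb' : b = 1 - a := by linarith
  calc _ ≤ a * (K * (b * ‖η - ζ‖) ^ 2) + b * (K * (a * ‖η - ζ‖) ^ 2) := add_le_add h3 h4
    _ = _ := by rw [hb']; ring

/-- The composition of a convex Lipschitz function with a map whose derivative is Lipschitz is weakly
convex: the modulus `ρ ≥ 2 L K` absorbs `L` times the error of `norm_map_combination_sub_le`. -/
theorem convexOn_comp_add_sq {T E : Type*} [NormedAddCommGroup T] [InnerProductSpace ℝ T]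
    [NormedAddCommGroup E] [NormedSpace ℝ E] {f : T → E} {f' : T → T →L[ℝ] E} {C : Set T}
    {K L ρ : ℝ} (hC : Convex ℝ C) (hf : ∀ z ∈ C, HasFDerivAt f (f' z) z) (hK : 0 ≤ K)
    (hLip : ∀ z ∈ C, ∀ z' ∈ C, ‖f' z - f' z'‖ ≤ K * ‖z - z'‖)
    {h : E → ℝ} {B : Set E} (hB : Convex ℝ B) (hh : ConvexOn ℝ B h) (hL : 0 ≤ L)
    (hhL : ∀ p ∈ B, ∀ q ∈ B, |h p - h q| ≤ L * ‖p - q‖) (hfB : MapsTo f C B)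
    (hρ : 2 * (L * K) ≤ ρ) :
    ConvexOn ℝ C (fun ξ => h (f ξ) + ρ / 2 * ‖ξ‖ ^ 2) := by
  refine ⟨hC, fun η hη ζ hζ a b ha hb hab => ?_⟩
  have h1 := norm_map_combination_sub_le hC hf hK hLip hη hζ ha hb hab
  have h2 := (le_abs_self _).trans (hhL _ (hfB (hC hη hζ ha hb hab)) _
    (hB (hfB hη) (hfB hζ) ha hb hab))
  have h3 := hh.2 (hfB hη) (hfB hζ) ha hb hab
  have h4 := mul_le_mul_of_nonneg_left h1 hL
  have hq : ‖a • η + b • ζ‖ ^ 2 = a * ‖η‖ ^ 2 + b * ‖ζ‖ ^ 2 - a * b * ‖η - ζ‖ ^ 2 := by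
    rw [norm_add_sq_real, norm_sub_sq_real, norm_smul, norm_smul, inner_smul_left,
      inner_smul_right, Real.norm_of_nonneg ha, Real.norm_of_nonneg hb]
    have hb' : b = 1 - a := by linarith
    simp only [conj_trivial]
    rw [hb']; ring
  have h5 : L * K * (a * b * ‖η - ζ‖ ^ 2) ≤ ρ / 2 * (a * b * ‖η - ζ‖ ^ 2) :=
    mul_le_mul_of_nonneg_right (by linarith) (by positivity)
  simp only [smul_eq_mul] at h3 ⊢
  rw [hq]
  linarith

/-! ### Submanifolds and local diffeomorphisms -/

variable {n : ℕ}

theorem OpenPartialHomeomorph.fderiv_symm_comp_fderiv {E : Type*} [NormedAddCommGroup E]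
    [NormedSpace ℝ E] (Φ : OpenPartialHomeomorph E E) (hΦ : ContDiffOn ℝ ∞ Φ Φ.source)
    (hΦs : ContDiffOn ℝ ∞ Φ.symm Φ.target) {p : E} (hp : p ∈ Φ.source) (v : E) :
    fderiv ℝ Φ.symm (Φ p) (fderiv ℝ Φ p v) = v := by
  have h1 : HasFDerivAt Φ (fderiv ℝ Φ p) p :=
    ((hΦ.contDiffAt (Φ.open_source.mem_nhds hp)).differentiableAt (by simp)).hasFDerivAt
  have h2 : HasFDerivAt Φ.symm (fderiv ℝ Φ.symm (Φ p)) (Φ p) :=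
    ((hΦs.contDiffAt (Φ.open_target.mem_nhds (Φ.map_source hp))).differentiableAt
      (by simp)).hasFDerivAt
  have h3 : HasFDerivAt id ((fderiv ℝ Φ.symm (Φ p)).comp (fderiv ℝ Φ p)) p :=
    (h2.comp p h1).congr_of_eventuallyEq (Φ.eventually_left_inverse hp |>.mono fun _ h => h.symm)
  exact congrArg (· v) (h3.unique (hasFDerivAt_id p))

/-- A slice chart maps a point of its domain into the model subspace exactly if the point lies on
the submanifold. -/
theorem slice_mem {M : Set (EuclideanSpace ℝ (Fin n))}
    {Φ : OpenPartialHomeomorph (EuclideanSpace ℝ (Fin n)) (EuclideanSpace ℝ (Fin n))}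
    {V : Submodule ℝ (EuclideanSpace ℝ (Fin n))} (hΦM : Φ '' (Φ.source ∩ M) = Φ.target ∩ V)
    {p : EuclideanSpace ℝ (Fin n)} (hp : p ∈ Φ.source) : p ∈ M ↔ Φ p ∈ V := by
  constructor
  · intro h
    exact (hΦM.subset ⟨p, ⟨hp, h⟩, rfl⟩).2
  · intro h
    obtain ⟨q, ⟨hq, hqM⟩, e⟩ := hΦM.superset ⟨Φ.map_source hp, h⟩
    rwa [← Φ.injOn hq hp e]

theorem Submodule.mem_of_hasDerivAt {E : Type*} [NormedAddCommGroup E] [NormedSpace ℝ E]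
    (V : Submodule ℝ E) (hV : IsClosed (V : Set E)) {c : ℝ → E} {v : E} {t : ℝ}
    (hc : HasDerivAt c v t) (hcV : ∀ᶠ s in 𝓝 t, c s ∈ V) : v ∈ V := by
  refine hV.mem_of_tendsto (hasDerivAt_iff_tendsto_slope.1 hc) ?_
  filter_upwards [hcV.filter_mono nhdsWithin_le_nhds] with s hs
  exact V.smul_mem _ (V.sub_mem hs hcV.self_of_nhds)

/-- The derivative of a slice chart with model subspace `V` maps `T_x M` injectively into `V`, and
the derivative of the inverse chart maps `V` injectively into `T_x M`. -/
theorem finrank_tangentSpaceOf {d : ℕ} {M : Set (EuclideanSpace ℝ (Fin n))}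
    (hM : IsEmbeddedSubmanifold d M) {x : EuclideanSpace ℝ (Fin n)} (hx : x ∈ M) :
    Module.finrank ℝ (tangentSpaceOf M x) = d := by
  obtain ⟨Φ, V, hxΦ, hΦ, hΦs, rfl, hΦM⟩ := hM x hx
  have hxt := Φ.map_source hxΦ
  have hdΦ : HasFDerivAt Φ (fderiv ℝ Φ x) x :=
    ((hΦ.contDiffAt (Φ.open_source.mem_nhds hxΦ)).differentiableAt (by simp)).hasFDerivAt
  have hdΦs : HasFDerivAt Φ.symm (fderiv ℝ Φ.symm (Φ x)) (Φ x) :=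
    ((hΦs.contDiffAt (Φ.open_target.mem_nhds hxt)).differentiableAt (by simp)).hasFDerivAt
  have inv1 := Φ.fderiv_symm_comp_fderiv hΦ hΦs hxΦ
  have inv2 := Φ.symm.fderiv_symm_comp_fderiv hΦs hΦ hxt
  rw [Φ.symm_symm, Φ.left_inv hxΦ] at inv2
  have hto : ∀ v ∈ tangentSpaceOf M x, fderiv ℝ Φ x v ∈ V := by
    change tangentSpaceOf M x ≤ V.comap (fderiv ℝ Φ x : _ →ₗ[ℝ] _)
    refine Submodule.span_le.2 ?_
    rintro v ⟨c, ε, hε, -, hcM, hc0, hcv⟩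
    have hdc : HasFDerivAt Φ (fderiv ℝ Φ x) (c 0) := by rwa [hc0]
    refine V.mem_of_hasDerivAt V.closed_of_finiteDimensional
      (hdc.comp_hasDerivAt (0 : ℝ) hcv) ?_
    filter_upwards [Ioo_mem_nhds (neg_lt_zero.2 hε) hε,
      hcv.continuousAt.eventually_mem (hc0.symm ▸ Φ.open_source.mem_nhds hxΦ)] with s hs hsΦ
    exact (slice_mem hΦM hsΦ).1 (hcM s hs)
  have hfrom : ∀ v ∈ V, fderiv ℝ Φ.symm (Φ x) v ∈ tangentSpaceOf M x := by
    intro v hv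
    have hline : HasDerivAt (fun t : ℝ => Φ x + t • v) v 0 := by
      simpa using ((hasDerivAt_id (0 : ℝ)).smul_const v).const_add (Φ x)
    have hnhds : ∀ᶠ t in 𝓝 (0 : ℝ), Φ x + t • v ∈ Φ.target :=
      hline.continuousAt.eventually_mem (Φ.open_target.mem_nhds (by simpa using hxt))
    obtain ⟨ε, hε, hεt⟩ := Metric.eventually_nhds_iff_ball.1 hnhds
    rw [Real.ball_eq_Ioo, zero_sub, zero_add] at hεt
    refine Submodule.subset_span ⟨fun t => Φ.symm (Φ x + t • v), ε, hε, ?_, ?_, ?_, ?_⟩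
    · exact hΦs.comp (by fun_prop) hεt
    · intro t ht
      refine (slice_mem hΦM (Φ.map_target (hεt t ht))).2 ?_
      rw [Φ.right_inv (hεt t ht)]
      exact V.add_mem ((slice_mem hΦM hxΦ).1 hx) (V.smul_mem _ hv)
    · simp [Φ.left_inv hxΦ]
    · exact HasFDerivAt.comp_hasDerivAt (0 : ℝ) (by simpa using hdΦs) hline
  -- Both restricted derivatives are injective, as they are inverse to each other.
  refine le_antisymm ?_ ?_
  · refine LinearMap.finrank_le_finrank_of_injective
      (f := (fderiv ℝ Φ x : _ →ₗ[ℝ] _).restrict hto) fun v w hvw => ?_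
    have : fderiv ℝ Φ x v = fderiv ℝ Φ x w := congrArg Subtype.val hvw
    exact Subtype.ext (by rw [← inv1 v, this, inv1])
  · refine LinearMap.finrank_le_finrank_of_injective
      (f := (fderiv ℝ Φ.symm (Φ x) : _ →ₗ[ℝ] _).restrict hfrom) fun v w hvw => ?_
    have : fderiv ℝ Φ.symm (Φ x) v = fderiv ℝ Φ.symm (Φ x) w := congrArg Subtype.val hvw
    exact Subtype.ext (by rw [← inv2 v, this, inv2])

/-- An injective immersion `f : A → M` of full dimension has, around each point of its image, a smooth
left inverse `G` defined on an open subset `W` of `ℝⁿ` with `W ∩ M` contained in the image. It is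
obtained from the inverse function theorem applied to `f` read in a slice chart and projected
orthogonally to the model subspace. -/
theorem exists_local_inverse {d : ℕ} {M : Set (EuclideanSpace ℝ (Fin n))}
    (hM : IsEmbeddedSubmanifold d M) {T : Type*} [NormedAddCommGroup T] [NormedSpace ℝ T]
    [FiniteDimensional ℝ T] (hT : Module.finrank ℝ T = d) {f : T → M} {A : Set T} (hA : IsOpen A)
    (hf : ContDiffOn ℝ ∞ (fun v => (f v : EuclideanSpace ℝ (Fin n))) A) (hinj : InjOn f A)
    (hf' : ∀ v ∈ A, Function.Injective
      (fderiv ℝ (fun v => (f v : EuclideanSpace ℝ (Fin n))) v)) {w : T} (hw : w ∈ A) :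
    ∃ (W : Set (EuclideanSpace ℝ (Fin n))) (G : EuclideanSpace ℝ (Fin n) → T),
      IsOpen W ∧ (f w : EuclideanSpace ℝ (Fin n)) ∈ W ∧ ContDiffOn ℝ ∞ G W ∧
      (∀ v ∈ A, (f v : EuclideanSpace ℝ (Fin n)) ∈ W → G (f v) = v) ∧
      ∀ q : M, (q : EuclideanSpace ℝ (Fin n)) ∈ W → q ∈ f '' A := by
  obtain ⟨Φ, V, hpΦ, hΦ, hΦs, rfl, hΦM⟩ := hM (f w) (f w).2
  have : CompleteSpace T := FiniteDimensional.complete ℝ T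
  set F : T → EuclideanSpace ℝ (Fin n) := fun v => f v
  set P := V.orthogonalProjectionOnto
  set A' : Set T := A ∩ F ⁻¹' Φ.source
  have hA'o : IsOpen A' := hf.continuousOn.isOpen_inter_preimage hA Φ.open_source
  have hwA' : w ∈ A' := ⟨hw, hpΦ⟩
  set φ : T → V := fun v => P (Φ (F v))
  have hφΦ : ∀ v ∈ A', (φ v : EuclideanSpace ℝ (Fin n)) = Φ (F v) := by
    intro v hv
    have hmem : Φ (F v) ∈ V := (slice_mem hΦM hv.2).1 (f v).2
    exact congrArg Subtype.val (V.orthogonalProjectionOnto_mem_subspace_eq_self ⟨_, hmem⟩)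
  have hFat : ∀ v ∈ A', ContDiffAt ℝ ∞ F v := fun v hv => hf.contDiffAt (hA.mem_nhds hv.1)
  have hΦat : ∀ v ∈ A', ContDiffAt ℝ ∞ Φ (F v) := fun v hv =>
    hΦ.contDiffAt (Φ.open_source.mem_nhds hv.2)
  have hφat : ∀ v ∈ A', ContDiffAt ℝ ∞ φ v := fun v hv =>
    P.contDiff.contDiffAt.comp v ((hΦat v hv).comp v (hFat v hv))
  -- The chart expression of `f` takes values in `V`, so the projection loses nothing.
  have hφinj : ∀ v ∈ A', Function.Injective (fderiv ℝ φ v) := by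
    intro v hv
    have h1 : HasFDerivAt (fun u => Φ (F u)) ((fderiv ℝ Φ (F v)).comp (fderiv ℝ F v)) v :=
      ((hΦat v hv).differentiableAt (by simp)).hasFDerivAt.comp v
        ((hFat v hv).differentiableAt (by simp)).hasFDerivAt
    have h2 : HasFDerivAt (fun u => Φ (F u)) (V.subtypeL.comp (fderiv ℝ φ v)) v := by
      refine (V.subtypeL.hasFDerivAt.comp v
        ((hφat v hv).differentiableAt (by simp)).hasFDerivAt).congr_of_eventuallyEq ?_
      filter_upwards [hA'o.mem_nhds hv] with u hu
      exact (hφΦ u hu).symm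
    intro a b hab
    have h3 : fderiv ℝ Φ (F v) (fderiv ℝ F v a) = fderiv ℝ Φ (F v) (fderiv ℝ F v b) := by
      have := h1.unique h2
      have ha := congrArg (· a) this
      have hb := congrArg (· b) this
      simp only [ContinuousLinearMap.comp_apply] at ha hb
      rw [ha, hb, hab]
    apply hf' v hv.1
    rw [← Φ.fderiv_symm_comp_fderiv hΦ hΦs hv.2 (fderiv ℝ F v a), h3,
      Φ.fderiv_symm_comp_fderiv hΦ hΦs hv.2]
  have hφequiv : ∀ v ∈ A', ∃ e : T ≃L[ℝ] V, HasFDerivAt φ (e : T →L[ℝ] V) v := by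
    intro v hv
    refine ⟨(LinearMap.linearEquivOfInjective (fderiv ℝ φ v : T →ₗ[ℝ] V) (hφinj v hv)
      hT).toContinuousLinearEquiv, ?_⟩
    exact ((hφat v hv).differentiableAt (by simp)).hasFDerivAt.congr_fderiv (by ext u; rfl)
  obtain ⟨e₀, he₀⟩ := hφequiv w hwA'
  set ψ := ((hφat w hwA').toOpenPartialHomeomorph φ he₀ (by simp)).restrOpen A' hA'o
  have hψA : ψ.source ⊆ A' := fun v hv => hv.2
  have hwψ : w ∈ ψ.source :=
    ⟨(hφat w hwA').mem_toOpenPartialHomeomorph_source he₀ (by simp), hwA'⟩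
  -- `ContDiffAt ℝ ∞` at one point does not give smoothness of any order on one common
  -- neighborhood, so smoothness of the inverse is checked at every point of the target.
  have hψs : ContDiffOn ℝ ∞ ψ.symm ψ.target := by
    intro q hq
    have hv := hψA (ψ.map_target hq)
    obtain ⟨e, he⟩ := hφequiv _ hv
    exact (ψ.contDiffAt_symm hq he (hφat _ hv)).contDiffWithinAt
  have hΦcont : ContinuousOn (fun q => P (Φ q)) Φ.source :=
    P.continuous.comp_continuousOn Φ.continuousOn
  have hF_inj : ∀ v ∈ A', ∀ q : M, (q : EuclideanSpace ℝ (Fin n)) ∈ Φ.source →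
      φ v = P (Φ q) → f v = q := by
    intro v hv q hq hvq
    have h1 : Φ q ∈ V := (slice_mem hΦM hq).1 q.2
    have h2 : Φ (F v) = Φ q := by
      rw [← hφΦ v hv, hvq]
      exact congrArg Subtype.val (V.orthogonalProjectionOnto_mem_subspace_eq_self ⟨_, h1⟩)
    exact Subtype.ext (Φ.injOn hv.2 hq h2)
  refine ⟨Φ.source ∩ (fun q => P (Φ q)) ⁻¹' ψ.target, fun q => ψ.symm (P (Φ q)),
    hΦcont.isOpen_inter_preimage Φ.open_source ψ.open_target, ⟨hpΦ, ψ.map_source hwψ⟩,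
    hψs.comp (P.contDiff.comp_contDiffOn (hΦ.mono inter_subset_left)) fun q hq => hq.2, ?_, ?_⟩
  · intro v hv hvW
    -- A priori `v` lies in `A` but perhaps not in the source of `ψ`; injectivity of `f` on all of `A`
    -- identifies it with the point supplied by `ψ.symm`.
    have h1 := ψ.map_target hvW.2
    exact hinj (hψA h1).1 hv (hF_inj _ (hψA h1) _ hvW.1 (ψ.right_inv hvW.2))
  · intro q hq
    have h1 := ψ.map_target hq.2
    exact ⟨_, (hψA h1).1, hF_inj _ (hψA h1) _ hq.1 (ψ.right_inv hq.2)⟩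

theorem isDiffeoOnto_image {d : ℕ} {M : Set (EuclideanSpace ℝ (Fin n))}
    (hM : IsEmbeddedSubmanifold d M) {T : Type*} [NormedAddCommGroup T] [NormedSpace ℝ T]
    [FiniteDimensional ℝ T] (hT : Module.finrank ℝ T = d) {f : T → M} {A : Set T} (hA : IsOpen A)
    (hf : ContDiffOn ℝ ∞ (fun v => (f v : EuclideanSpace ℝ (Fin n))) A) (hinj : InjOn f A)
    (hf' : ∀ v ∈ A, Function.Injective
      (fderiv ℝ (fun v => (f v : EuclideanSpace ℝ (Fin n))) v)) :
    IsDiffeoOnto f A (f '' A) := by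
  refine ⟨hA, ?_, hinj.bijOn_image, hf, ?_⟩
  · rw [isOpen_iff_mem_nhds]
    rintro _ ⟨w, hw, rfl⟩
    obtain ⟨W, G, hW, hwW, -, -, hsub⟩ := exists_local_inverse hM hT hA hf hinj hf' hw
    exact mem_of_superset ((hW.preimage continuous_subtype_val).mem_nhds hwW) hsub
  · rintro _ ⟨w, hw, rfl⟩
    obtain ⟨W, G, hW, hwW, hG, hinv, -⟩ := exists_local_inverse hM hT hA hf hinj hf' hw
    exact ⟨W, G, hW, hwW, hG, hinv⟩

/-! ### Uniform estimates for retractions -/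

/-- The derivatives of the maps `R_y`, for `y` near `x`, are Lipschitz near `0` with a common constant:
they are restrictions of the derivative of one smooth extension of `R` around `(x, 0)`. -/
theorem IsRetraction.exists_fderiv_lipschitz {M : Set (EuclideanSpace ℝ (Fin n))}
    {R : (x : M) → tangentSpaceOf M x → M} (hR : IsRetraction M R) (x : M) :
    ∃ δ > (0 : ℝ), ∃ K : ℝ, 0 ≤ K ∧ ∀ y : M,
      dist (y : EuclideanSpace ℝ (Fin n)) x < δ →
        ContDiffOn ℝ ∞ (fun v => (R y v : EuclideanSpace ℝ (Fin n))) (Metric.ball 0 δ) ∧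
        ∀ v ∈ Metric.ball (0 : tangentSpaceOf M y) δ,
          ∀ w ∈ Metric.ball (0 : tangentSpaceOf M y) δ,
            ‖fderiv ℝ (fun v => (R y v : EuclideanSpace ℝ (Fin n))) v -
              fderiv ℝ (fun v => (R y v : EuclideanSpace ℝ (Fin n))) w‖ ≤ K * ‖v - w‖ := by
  obtain ⟨W, F, hW, hxW, hF, hFR⟩ := hR.smooth x 0
  have hFx : ContDiffAt ℝ ∞ F (x, (0 : tangentSpaceOf M x)) := hF.contDiffAt (hW.mem_nhds hxW)
  obtain ⟨K, t, ht, hK⟩ :=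
    (hFx.fderiv_right (m := 1) (WithTop.coe_le_coe.2 le_top)).exists_lipschitzOnWith
  obtain ⟨δ, hδ, hball⟩ := Metric.mem_nhds_iff.1 (inter_mem (hW.mem_nhds hxW) ht)
  refine ⟨δ, hδ, K, K.2, fun y hy => ?_⟩
  set ι : tangentSpaceOf M y → EuclideanSpace ℝ (Fin n) × EuclideanSpace ℝ (Fin n) :=
    fun v => ((y : EuclideanSpace ℝ (Fin n)), (v : EuclideanSpace ℝ (Fin n))) with hι
  have hιball : ∀ v ∈ Metric.ball (0 : tangentSpaceOf M y) δ, ι v ∈ W ∧ ι v ∈ t := by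
    intro v hv
    refine hball ?_
    rw [← ball_prod_same]
    refine ⟨hy, ?_⟩
    simpa using hv
  have hRF : ∀ v ∈ Metric.ball (0 : tangentSpaceOf M y) δ,
      (R y v : EuclideanSpace ℝ (Fin n)) = F (ι v) :=
    fun v hv => (hFR y v (hιball v hv).1).symm
  have hιs : ContDiff ℝ ∞ ι := contDiff_const.prodMk (tangentSpaceOf M y).subtypeL.contDiff
  have hιd : ∀ v, HasFDerivAt ι ((0 : _ →L[ℝ] EuclideanSpace ℝ (Fin n)).prod
      (tangentSpaceOf M y).subtypeL) v := fun v =>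
    (hasFDerivAt_const _ _).prodMk (tangentSpaceOf M y).subtypeL.hasFDerivAt
  have hder : ∀ v ∈ Metric.ball (0 : tangentSpaceOf M y) δ,
      fderiv ℝ (fun v => (R y v : EuclideanSpace ℝ (Fin n))) v =
        (fderiv ℝ F (ι v)).comp ((0 : _ →L[ℝ] EuclideanSpace ℝ (Fin n)).prod
          (tangentSpaceOf M y).subtypeL) := by
    intro v hv
    refine HasFDerivAt.fderiv ?_
    have h1 : HasFDerivAt F (fderiv ℝ F (ι v)) (ι v) :=
      ((hF.contDiffAt (hW.mem_nhds (hιball v hv).1)).differentiableAt (by simp)).hasFDerivAt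
    refine (h1.comp v (hιd v)).congr_of_eventuallyEq ?_
    filter_upwards [Metric.isOpen_ball.mem_nhds hv] with u hu
    exact hRF u hu
  refine ⟨(hF.comp hιs.contDiffOn fun v hv => (hιball v hv).1).congr hRF, fun v hv w hw => ?_⟩
  rw [hder v hv, hder w hw, ← ContinuousLinearMap.sub_comp]
  refine ContinuousLinearMap.opNorm_le_bound _ (by positivity) fun u => ?_
  have h1 := hK.norm_sub_le (hιball v hv).2 (hιball w hw).2
  have h2 : ι v - ι w = (0, ((v - w : tangentSpaceOf M y) : EuclideanSpace ℝ (Fin n))) :=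
    Prod.ext (sub_self _) rfl
  rw [h2, Prod.norm_mk, norm_zero, max_eq_right (norm_nonneg _)] at h1
  have h3 := (fderiv ℝ F (ι v) - fderiv ℝ F (ι w)).le_of_opNorm_le h1
    ((0 : EuclideanSpace ℝ (Fin n)), (u : EuclideanSpace ℝ (Fin n)))
  rw [Prod.norm_mk, norm_zero, max_eq_right (norm_nonneg _)] at h3
  exact h3

/-- A radius and a modulus valid for all base points `y` near `x`: on the `r`-ball of `T_y M`, the map
`R_y` is smooth, within `1/2` of the inclusion, immersive, and `h ∘ R_y` is `ρ`-weakly convex. -/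
theorem IsRetraction.exists_uniform_radius {M : Set (EuclideanSpace ℝ (Fin n))}
    {R : (x : M) → tangentSpaceOf M x → M} (hR : IsRetraction M R)
    {h : EuclideanSpace ℝ (Fin n) → ℝ} (hh : ConvexOn ℝ univ h) (x : M) :
    ∃ r > (0 : ℝ), ∃ ρ > (0 : ℝ), ∀ y : M, dist (y : EuclideanSpace ℝ (Fin n)) x < r →
      ContDiffOn ℝ ∞ (fun v => (R y v : EuclideanSpace ℝ (Fin n))) (Metric.ball 0 r) ∧
      (∀ v ∈ Metric.ball (0 : tangentSpaceOf M y) r, ∀ w ∈ Metric.ball (0 : tangentSpaceOf M y) r,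
        ‖(R y v : EuclideanSpace ℝ (Fin n)) - R y w - (v - w)‖ ≤ 1 / 2 * ‖v - w‖) ∧
      (∀ v ∈ Metric.ball (0 : tangentSpaceOf M y) r, Function.Injective
        (fderiv ℝ (fun v => (R y v : EuclideanSpace ℝ (Fin n))) v)) ∧
      ConvexOn ℝ (Metric.ball (0 : tangentSpaceOf M y) r)
        (fun v => h (R y v) + ρ / 2 * ‖v‖ ^ 2) := by
  obtain ⟨δ, hδ, K, hK, hRδ⟩ := hR.exists_fderiv_lipschitz x
  obtain ⟨L, t, ht, hL⟩ := hh.locallyLipschitz (x : EuclideanSpace ℝ (Fin n))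
  obtain ⟨ε, hε, hεt⟩ := Metric.mem_nhds_iff.1 ht
  obtain ⟨r, hr, hrδ, hrK, hrε⟩ : ∃ r > 0, r ≤ δ ∧ K * r ≤ 1 / 2 ∧ 3 * r ≤ ε := by
    refine ⟨min δ (min (1 / (2 * (K + 1))) (ε / 3)), by positivity, min_le_left _ _, ?_, ?_⟩
    · have h1 : min δ (min (1 / (2 * (K + 1))) (ε / 3)) ≤ 1 / (2 * (K + 1)) :=
        (min_le_right _ _).trans (min_le_left _ _)
      refine (mul_le_mul_of_nonneg_left h1 hK).trans ?_
      rw [mul_one_div, div_le_div_iff₀ (by positivity) two_pos]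
      linarith
    · have h1 : min δ (min (1 / (2 * (K + 1))) (ε / 3)) ≤ ε / 3 :=
        (min_le_right _ _).trans (min_le_right _ _)
      linarith
  -- The summand `1` only serves to make the modulus positive.
  refine ⟨r, hr, 2 * (L * K) + 1, by positivity, fun y hy => ?_⟩
  obtain ⟨hsm, hlip⟩ := hRδ y (hy.trans_le hrδ)
  have hsub : Metric.ball (0 : tangentSpaceOf M y) r ⊆ Metric.ball 0 δ :=
    Metric.ball_subset_ball hrδ
  set f : tangentSpaceOf M y → EuclideanSpace ℝ (Fin n) := fun v => R y v
  have hd : ∀ v ∈ Metric.ball (0 : tangentSpaceOf M y) r, HasFDerivAt f (fderiv ℝ f v) v :=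
    fun v hv => ((hsm.contDiffAt (Metric.isOpen_ball.mem_nhds (hsub hv))).differentiableAt
      (by simp)).hasFDerivAt
  have h0 : fderiv ℝ f 0 = (tangentSpaceOf M y).subtypeL := (hR.hasFDerivAt_zero y).fderiv
  have hclose : ∀ v ∈ Metric.ball (0 : tangentSpaceOf M y) r,
      ‖fderiv ℝ f v - (tangentSpaceOf M y).subtypeL‖ ≤ 1 / 2 := by
    intro v hv
    have h1 := hlip v (hsub hv) 0 (Metric.mem_ball_self hδ)
    rw [h0, sub_zero] at h1
    exact h1.trans ((mul_le_mul_of_nonneg_left (mem_ball_zero_iff.1 hv).le hK).trans hrK)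
  have hiso : ∀ v ∈ Metric.ball (0 : tangentSpaceOf M y) r,
      ∀ w ∈ Metric.ball (0 : tangentSpaceOf M y) r,
        ‖f v - f w - ((v : EuclideanSpace ℝ (Fin n)) - w)‖ ≤ 1 / 2 * ‖v - w‖ := by
    intro v hv w hw
    have h1 := (convex_ball (0 : tangentSpaceOf M y)
      r).norm_image_sub_le_of_norm_hasFDerivWithin_le' (fun u hu => (hd u hu).hasFDerivWithinAt)
      hclose hw hv
    rwa [map_sub] at h1
  refine ⟨hsm.mono hsub, hiso, fun v hv => ?_, ?_⟩
  · refine (injective_iff_map_eq_zero (fderiv ℝ f v)).2 fun u hu => ?_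
    have h1 := (fderiv ℝ f v - (tangentSpaceOf M y).subtypeL).le_of_opNorm_le (hclose v hv) u
    have h2 : ‖(u : EuclideanSpace ℝ (Fin n))‖ ≤ 1 / 2 * ‖u‖ := by
      simpa [hu] using h1
    rw [Submodule.coe_norm] at h2
    rw [← norm_le_zero_iff, Submodule.coe_norm]
    linarith
  · refine convexOn_comp_add_sq (B := Metric.ball (x : EuclideanSpace ℝ (Fin n)) ε)
      (convex_ball _ _) hd hK (fun z hz z' hz' => hlip z (hsub hz) z' (hsub hz')) (convex_ball _ _)
      (hh.subset (subset_univ _) (convex_ball _ _)) L.2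
      (fun p hp q hq => hL.norm_sub_le (hεt hp) (hεt hq)) (fun v hv => ?_) (by simp)
    have h1 := hiso v hv 0 (Metric.mem_ball_self hr)
    have h2 : f 0 = y := congrArg Subtype.val (hR.map_zero y)
    rw [h2, ZeroMemClass.coe_zero, sub_zero, sub_zero] at h1
    have h3 : ‖v‖ < r := mem_ball_zero_iff.1 hv
    have h4 : dist (f v) (y : EuclideanSpace ℝ (Fin n)) ≤ 1 / 2 * ‖v‖ + ‖v‖ := by
      rw [dist_eq_norm, ← sub_add_cancel (f v - y) (v : EuclideanSpace ℝ (Fin n))]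
      exact (norm_add_le _ _).trans (add_le_add_left h1 _)
    rw [Metric.mem_ball]
    linarith [dist_triangle (f v) y x]

/-! ### Weak convexity of pullbacks along a retraction -/

/-- If the image of the `s`-ball is open in `M` and no point of the sphere of radius `s` is mapped into
the connected set `U`, then the image meets `U` in a clopen subset, hence contains `U`. -/
theorem image_subset_image_ball {M : Set (EuclideanSpace ℝ (Fin n))} {T : Type*}
    [NormedAddCommGroup T] [NormedSpace ℝ T] [FiniteDimensional ℝ T] {f : T → M} {U : Set M}
    {s r : ℝ} (hsr : s < r) (hs : 0 < s) (hU : IsPreconnected U)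
    (hf : ContinuousOn f (Metric.ball 0 r)) (hopen : IsOpen (f '' Metric.ball 0 s))
    (h0 : f 0 ∈ U) (hlow : ∀ v ∈ Metric.closedBall (0 : T) s, f v ∈ U → ‖v‖ < s) :
    U ⊆ f '' Metric.ball 0 s := by
  have hcomp : IsCompact (f '' Metric.closedBall 0 s) :=
    (isCompact_closedBall _ _).image_of_continuousOn
      (hf.mono (Metric.closedBall_subset_ball hsr))
  refine hU.subset_of_closure_inter_subset hopen ⟨_, h0, 0, Metric.mem_ball_self hs, rfl⟩ ?_
  rintro u ⟨hu, huU⟩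
  obtain ⟨v, hv, rfl⟩ :=
    closure_minimal (image_mono Metric.ball_subset_closedBall) hcomp.isClosed hu
  exact ⟨v, mem_ball_zero_iff.2 (hlow v hv huU), rfl⟩

theorem lemmaB3 {n d : ℕ} (M : Set (EuclideanSpace ℝ (Fin n))) (hM : IsEmbeddedSubmanifold d M)
    (R : (x : M) → tangentSpaceOf M x → M) (hR : IsRetraction M R)
    (h : EuclideanSpace ℝ (Fin n) → ℝ) (hh : ConvexOn ℝ univ h) (x : M) :
    ∃ (A : Set (tangentSpaceOf M x)) (U : Set M),
      (0 : tangentSpaceOf M x) ∈ A ∧ x ∈ U ∧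
      -- (i) the retraction is a diffeomorphism from `A` onto `U`
      IsDiffeoOnto (R x) A U ∧
      -- (ii) the pullback is weakly convex on `A`
      IsWeaklyConvexOn (fun η => h (R x η)) A ∧
      -- (iii) `h` is weakly retraction-convex on `U`, with one constant for all `y ∈ U`; the
      -- tangent vectors at `y` range over a neighborhood of `0` on which `R y` is a
      -- diffeomorphism and whose image contains `U`
      ∃ D : (y : M) → Set (tangentSpaceOf M y),
        A ⊆ D x ∧
        (∀ y ∈ U, (0 : tangentSpaceOf M y) ∈ D y ∧
          ∃ V : Set M, U ⊆ V ∧ IsDiffeoOnto (R y) (D y) V) ∧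
        ∃ ρ : ℝ, 0 < ρ ∧ RetractionConvexOn R D ρ (fun p : M => h p) U := by
  obtain ⟨r, hr, ρ, hρ, hRr⟩ := hR.exists_uniform_radius hh x
  have hhL := hh.locallyLipschitz
  have hR0 : ∀ y : M, (R y 0 : EuclideanSpace ℝ (Fin n)) = y :=
    fun y => congrArg Subtype.val (hR.map_zero y)
  have hcont : ∀ y : M, dist (y : EuclideanSpace ℝ (Fin n)) x < r →
      ContinuousOn (R y) (Metric.ball 0 r) := fun y hy =>
    Topology.IsInducing.subtypeVal.continuousOn_iff.2 (hRr y hy).1.continuousOn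
  have hhcont : ∀ y : M, dist (y : EuclideanSpace ℝ (Fin n)) x < r →
      ContinuousOn (fun v => h (R y v)) (Metric.ball 0 r) := fun y hy =>
    hhL.continuous.comp_continuousOn (hRr y hy).1.continuousOn
  have hbounds : ∀ y : M, dist (y : EuclideanSpace ℝ (Fin n)) x < r →
      ∀ v ∈ Metric.ball (0 : tangentSpaceOf M y) r, ∀ w ∈ Metric.ball (0 : tangentSpaceOf M y) r,
        ‖(R y v : EuclideanSpace ℝ (Fin n)) - R y w‖ ≤ 3 / 2 * ‖v - w‖ ∧
        1 / 2 * ‖v - w‖ ≤ ‖(R y v : EuclideanSpace ℝ (Fin n)) - R y w‖ := by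
    intro y hy v hv w hw
    have h1 := (hRr y hy).2.1 v hv w hw
    have h2 : ‖(v : EuclideanSpace ℝ (Fin n)) - w‖ = ‖v - w‖ := rfl
    have h3 := norm_sub_norm_le ((R y v : EuclideanSpace ℝ (Fin n)) - R y w) (v - w)
    have h4 := norm_sub_norm_le ((v : EuclideanSpace ℝ (Fin n)) - w) (R y v - R y w)
    rw [norm_sub_rev ((v : EuclideanSpace ℝ (Fin n)) - w)] at h4
    constructor <;> linarith
  have hdiff : ∀ y : M, dist (y : EuclideanSpace ℝ (Fin n)) x < r → ∀ s ≤ r,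
      IsDiffeoOnto (R y) (Metric.ball 0 s) (R y '' Metric.ball 0 s) := by
    intro y hy s hs
    have hsub : Metric.ball (0 : tangentSpaceOf M y) s ⊆ Metric.ball 0 r :=
      Metric.ball_subset_ball hs
    refine isDiffeoOnto_image hM (finrank_tangentSpaceOf hM y.2) Metric.isOpen_ball
      ((hRr y hy).1.mono hsub) (fun v hv w hw hvw => ?_) (fun v hv => (hRr y hy).2.2.1 v (hsub hv))
    have h1 := (hbounds y hy v (hsub hv) w (hsub hw)).2
    rw [hvw, sub_self, norm_zero] at h1
    exact sub_eq_zero.1 (norm_le_zero_iff.1 (by linarith))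
  have hxr : dist (x : EuclideanSpace ℝ (Fin n)) x < r := by simpa using hr
  set A : Set (tangentSpaceOf M x) := Metric.ball 0 (r / 12)
  have hAr : A ⊆ Metric.ball 0 r := Metric.ball_subset_ball (by linarith)
  set U : Set M := R x '' A
  have hUdist : ∀ y ∈ U, dist (y : EuclideanSpace ℝ (Fin n)) x < r / 8 := by
    rintro _ ⟨v, hv, rfl⟩
    have h1 := (hbounds x hxr v (hAr hv) 0 (Metric.mem_ball_self hr)).1
    rw [hR0, sub_zero] at h1
    rw [dist_eq_norm]
    linarith [mem_ball_zero_iff.1 hv]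
  have hUr : ∀ y ∈ U, dist (y : EuclideanSpace ℝ (Fin n)) x < r :=
    fun y hy => (hUdist y hy).trans (by linarith)
  -- Two points of `U` are less than `r / 4` apart, and `R y v` is at distance at least `‖v‖ / 2`
  -- from `y`; so `R y v ∈ U` forces `‖v‖ < r / 2`.
  have hD : ∀ y ∈ U, U ⊆ R y '' Metric.ball 0 (r / 2) := by
    intro y hy
    refine image_subset_image_ball (r := r) (by linarith) (by linarith)
      (((convex_ball _ _).isPreconnected).image _ ((hcont x hxr).mono hAr)) (hcont y (hUr y hy))
      (hdiff y (hUr y hy) (r / 2) (by linarith)).2.1 (by rwa [hR.map_zero]) fun v hv hvU => ?_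
    have hv' : v ∈ Metric.ball (0 : tangentSpaceOf M y) r :=
      Metric.closedBall_subset_ball (by linarith) hv
    have h1 := (hbounds y (hUr y hy) v hv' 0 (Metric.mem_ball_self hr)).2
    rw [hR0, sub_zero, ← dist_eq_norm] at h1
    linarith [dist_triangle_right (R y v : EuclideanSpace ℝ (Fin n)) y x, hUdist _ hvU,
      hUdist y hy]
  have hxU : x ∈ U := ⟨0, Metric.mem_ball_self (by linarith), hR.map_zero x⟩
  refine ⟨A, U, Metric.mem_ball_self (by linarith), hxU, hdiff x hxr _ (by linarith), ⟨?_, ρ, hρ, ?_⟩,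
    fun y => Metric.ball 0 (r / 2), Metric.ball_subset_ball (by linarith), fun y hy =>
      ⟨Metric.mem_ball_self (by linarith), _, hD y hy, hdiff y (hUr y hy) _ (by linarith)⟩,
    ρ, hρ, ?_, ?_⟩
  · have hRL : LipschitzOnWith (3 / 2) (fun v => (R x v : EuclideanSpace ℝ (Fin n))) A :=
      LipschitzOnWith.of_dist_le_mul fun v hv w hw => by
        simpa [dist_eq_norm] using (hbounds x hxr v (hAr hv) w (hAr hw)).1
    intro w hw
    obtain ⟨L, t, ht, hL⟩ := hhL (R x w : EuclideanSpace ℝ (Fin n))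
    refine ⟨L * (3 / 2), _, inter_mem (hRL.continuousOn w hw ht) self_mem_nhdsWithin,
      hL.comp (hRL.mono inter_subset_right) fun v hv => hv.1⟩
  · intro w hw η hη g hg
    have h1 := le_of_mem_clarkeSubdiff Metric.isOpen_ball (hRr x hxr).2.2.2 (hhcont x hxr)
      (hAr hw) (hAr hη) hg
    linarith
  · intro p _
    obtain ⟨L, t, ht, hL⟩ := hhL (p : EuclideanSpace ℝ (Fin n))
    refine ⟨L * 1, _, mem_nhdsWithin_of_mem_nhds (continuous_subtype_val.continuousAt ht),
      hL.comp (LipschitzWith.subtype_val M).lipschitzOnWith fun q hq => hq⟩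
  · intro y hy S hS _ w hw
    have hSr : ∀ v ∈ S, v ∈ Metric.ball (0 : tangentSpaceOf M y) r := fun v hv =>
      Metric.ball_subset_ball (by linarith) (hS hv)
    have hconv := (hRr y (hUr y hy)).2.2.2
    have hct : ContinuousOn (fun v => h (R y v) + ρ / 2 * ‖v‖ ^ 2) (Metric.ball 0 r) :=
      (hhcont y (hUr y hy)).add (by fun_prop)
    refine ⟨hconv.clarkeSubdiff_nonempty Metric.isOpen_ball hct (hSr w hw), fun v hv η hη => ?_⟩
    -- The quadratic term is now part of the function, which is genuinely convex.
    have h1 := le_of_mem_clarkeSubdiff (ρ := 0) Metric.isOpen_ball (by simpa using hconv) hct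
      (hSr w hw) (hSr η hη) hv
    linarith
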